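/- Let $\alpha>0$ and let $H$ be a probability distribution on $[0,\infty)$, identified with its distribution function. Let $F$ be a Dirichlet process $\mathrm{DP}(\alpha,H)$, i.e. a random probability measure on $[0,\infty)$ such that for every finite measurable partition $(B_1,\dots,B_k)$ of $[0,\infty)$ the vector $(F(B_1),\dots,F(B_k))$ has the Dirichlet distribution with parameters $(\alpha H(B_1),\dots,\alpha H(B_k))$ (a coordinate with parameter $0$ being almost surely $0$). Let $T_1,T_2,\dots$ be $[0,\infty)$-valued random variables which, conditionally on $F$, are independent with common distribution $F$. Put $S_0=0$, $S_n=T_1+\cdots+T_n$, $N(t)=\sup\{n\ge 0:S_n\le t\}$ and $U(t)=\mathbb E[N(t)]\in[0,\infty]$ for $t\ge 0$. Write $(\alpha)_n=\alpha(\alpha+1)\cdots(\alpha+n-1)$ and, for $j\ge1$, let $H_j$ be the distribution with distribution function $H_j(t)=H(t/j)$; $*$ denotes convolution of distributions, $H_j^{*m}$ the $m$-fold convolution and $H_j^{*0}$ the unit point mass at $0$. Then: (i) for every $n\in\mathbb N$ and $t\ge 0$, $$\mathbb P(S_n\le t)=\frac{n!}{(\alpha)_n}\sum_{v}\left(\prod_{j=1}^n\frac{\alpha^{v_j}}{j^{v_j}\,v_j!}\right)\left(H_1^{*v_1}*H_2^{*v_2}*\cdots*H_n^{*v_n}\right)(t),$$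 where the sum runs over all vectors $v=(v_1,\dots,v_n)$ of non-negative integers with $\sum_{j=1}^n j\,v_j=n$; (ii) for every $t\ge 0$, as an identity in $[0,\infty]$, $$U(t)=\sum_{n=1}^\infty\frac{n!}{(\alpha)_n}\sum_{v}\left(\prod_{j=1}^n\frac{\alpha^{v_j}}{j^{v_j}\,v_j!}\right)\left(H_1^{*v_1}*H_2^{*v_2}*\cdots*H_n^{*v_n}\right)(t),$$ with the inner sum over the same vectors $v$ as in (i). -/

import Mathlib

open MeasureTheory ProbabilityTheory
open scoped NNReal ENNReal Nat

noncomputable section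

/-- The gamma distribution with shape `a ≥ 0` and rate `1`, with the usual convention that shape
`0` means the unit point mass at `0`. -/
def gammaLaw (a : ℝ) : Measure ℝ :=
  if a = 0 then Measure.dirac 0 else gammaMeasure a 1

/-- The Dirichlet distribution with parameters `a i ≥ 0`, not all zero: the law of
`(G i / ∑ l, G l)_i` for independent `G i` with gamma laws of shape `a i` and rate `1`.
Coordinates with parameter `0` vanish. -/
def dirichletLaw {k : ℕ} (a : Fin k → ℝ) : Measure (Fin k → ℝ) :=
  (Measure.pi fun i => gammaLaw (a i)).map fun g i => g i / ∑ l, g l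

/-- `F` is a Dirichlet process with precision `α` and base distribution `H`: a random probability
measure whose values on every finite measurable partition `B` have the Dirichlet distribution with
parameters `α * H (B i)`. -/
structure IsDirichletProcess {Ω S : Type*} [MeasurableSpace Ω] [MeasurableSpace S]
    (F : Ω → ProbabilityMeasure S) (α : ℝ) (H : Measure S) (P : Measure Ω) : Prop where
  measurable : Measurable F
  hasLaw : ∀ (k : ℕ) (B : Fin k → Set S), (∀ i, MeasurableSet (B i)) →
    (∀ i j, i ≠ j → Disjoint (B i) (B j)) → (⋃ i, B i) = Set.univ →
    HasLaw (fun ω i => (F ω : Measure S).real (B i)) (dirichletLaw fun i => α * H.real (B i)) P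

/-- Given the random probability measure `F`, the `T i` are independent with distribution `F`:
`P(T 0 ∈ A 0, …, T (n - 1) ∈ A (n - 1) | F) = F (A 0) ⋯ F (A (n - 1))` almost surely. -/
structure IsCondIID {Ω S : Type*} [MeasurableSpace Ω] [MeasurableSpace S]
    (T : ℕ → Ω → S) (F : Ω → ProbabilityMeasure S) (P : Measure Ω) : Prop where
  measurable : ∀ i, Measurable (T i)
  condProb : ∀ (n : ℕ) (A : Fin n → Set S), (∀ i, MeasurableSet (A i)) →
    P⟦{ω | ∀ i : Fin n, T i ω ∈ A i} | MeasurableSpace.comap F inferInstance⟧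
      =ᵐ[P] fun ω => ∏ i, (F ω : Measure S).real (A i)

/-- The adding process `S_n`, the sum of the first `n` inter-arrival times `T 0, …, T (n - 1)`
(`T i` stands for `T_{i+1}`). -/
def addingProcess {Ω : Type*} (T : ℕ → Ω → ℝ≥0) (n : ℕ) (ω : Ω) : ℝ≥0 :=
  ∑ i ∈ Finset.range n, T i ω

/-- The mixed renewal process `N(t) = sup {n : S_n ≤ t}`, with values in `{0, 1, …, ∞}`. -/
def mixedRenewalProcess {Ω : Type*} (T : ℕ → Ω → ℝ≥0) (t : ℝ≥0) (ω : Ω) : ℕ∞ :=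
  sSup {m : ℕ∞ | ∃ n : ℕ, m = n ∧ addingProcess T n ω ≤ t}

/-- The mixed renewal function `U(t) = E N(t)`, with values in `[0, ∞]`. -/
def mixedRenewalFunction {Ω : Type*} [MeasurableSpace Ω] (P : Measure Ω) (T : ℕ → Ω → ℝ≥0)
    (t : ℝ≥0) : ℝ≥0∞ :=
  ∫⁻ ω, (mixedRenewalProcess T t ω : ℝ≥0∞) ∂P

/-- `H_j`, the law of `j * X` for `X` with law `H`; its distribution function is `t ↦ H(t / j)`,
see `scaledLaw_Iic`. -/
def scaledLaw (H : Measure ℝ≥0) (j : ℕ) : Measure ℝ≥0 :=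
  H.map fun x => (j : ℝ≥0) * x

theorem scaledLaw_Iic (H : Measure ℝ≥0) {j : ℕ} (hj : 1 ≤ j) (t : ℝ≥0) :
    scaledLaw H j (Set.Iic t) = H (Set.Iic (t / j)) := by
  have hj' : (0 : ℝ≥0) < j := by exact_mod_cast hj
  rw [scaledLaw, Measure.map_apply (by fun_prop) measurableSet_Iic]
  congr 1
  ext x
  simp [le_div_iff₀ hj', mul_comm]

/-- The `m`-fold convolution `μ^{*m}`; `μ^{*0}` is the point mass at `0`. -/
def convPow (μ : Measure ℝ≥0) : ℕ → Measure ℝ≥0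
  | 0 => Measure.dirac 0
  | m + 1 => (convPow μ m).conv μ

/-- `H_1^{*v_1} * H_2^{*v_2} * ⋯ * H_n^{*v_n}`; the entry `v j` stands for `v_{j+1}`. -/
def partitionConv (H : Measure ℝ≥0) {n : ℕ} (v : Fin n → ℕ) : Measure ℝ≥0 :=
  (List.ofFn fun j : Fin n => convPow (scaledLaw H (j + 1)) (v j)).foldr Measure.conv
    (Measure.dirac 0)

/-- The vectors `v = (v_1, …, v_n)` of natural numbers with `∑ j v_j = n` (see
`mem_partitionVectors`); the entry `v j` stands for `v_{j+1}`. -/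
def partitionVectors (n : ℕ) : Finset (Fin n → ℕ) :=
  (Fintype.piFinset fun _ => Finset.range (n + 1)).filter fun v => ∑ j, (j.val + 1) * v j = n

theorem mem_partitionVectors {n : ℕ} {v : Fin n → ℕ} :
    v ∈ partitionVectors n ↔ ∑ j, (j.val + 1) * v j = n := by
  simp only [partitionVectors, Finset.mem_filter, Fintype.mem_piFinset, Finset.mem_range,
    and_iff_right_iff_imp]
  intro h i
  have h1 : (i.val + 1) * v i ≤ ∑ j, (j.val + 1) * v j :=
    Finset.single_le_sum (f := fun j : Fin n => (j.val + 1) * v j) (fun _ _ => Nat.zero_le _)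
      (Finset.mem_univ i)
  nlinarith [Nat.zero_le (i.val * v i)]

/-- `(α)_n = α (α + 1) ⋯ (α + n - 1)`. -/
def risingFactorial (α : ℝ) (n : ℕ) : ℝ :=
  ∏ i ∈ Finset.range n, (α + i)

end

/-! The law of `S_n` is identified through its characteristic function, which is `E ∏ f(T_i)` for
`f(x) = exp(iθx)`. If `f` is simple, with value `c_i` on `B_i`, conditioning on `F` gives `E (∑ c_i
F(B_i))^n`, a moment of a Dirichlet vector with parameters `a_i = α H(B_i)`.

The mixed moments of that vector are `∏ (a_i)_{m_i} / (α)_n`. By the multinomial theorem the moment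
is therefore `n!/(α)_n` times the coefficient of `X^n` in `∏ (1 - c_i X)^(-a_i)`. This product
equals `exp (∑_j p_j X^j / j)` with `p_j = ∑ a_i c_i^j = α ∫ f^j dH`, and expanding the exponential
yields the sum over `v` (`coeff_prod_negBinomialSeries`). The result no longer mentions the
partition, so it passes to bounded measurable `f` by dominated convergence
(`IsCondIID.integral_prod_of_norm_le`).

For `f(x) = exp(iθx)`, `∫ f^j dH` is the characteristic function of `H_j`, so each summand is that
of a convolution, and uniqueness gives (i) as an equality of measures (`map_addingProcess`). Part
(ii) follows from `N(t) = ∑_{n ≥ 1} 1{S_n ≤ t}` and Tonelli. -/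

/-! ### Rising factorials and tilted moments of gamma laws. -/

theorem risingFactorial_zero (a : ℝ) : risingFactorial a 0 = 1 := by
  simp [risingFactorial]

theorem risingFactorial_succ (a : ℝ) (m : ℕ) :
    risingFactorial a (m + 1) = risingFactorial a m * (a + m) := by
  simp [risingFactorial, Finset.prod_range_succ]

theorem risingFactorial_pos {a : ℝ} (ha : 0 < a) (m : ℕ) : 0 < risingFactorial a m :=
  Finset.prod_pos fun i _ => by positivity

theorem risingFactorial_nonneg {a : ℝ} (ha : 0 ≤ a) (m : ℕ) : 0 ≤ risingFactorial a m :=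
  Finset.prod_nonneg fun i _ => by positivity

theorem Gamma_add_natCast {a : ℝ} (ha : 0 < a) (m : ℕ) :
    Real.Gamma (a + m) = risingFactorial a m * Real.Gamma a := by
  induction m with
  | zero => simp [risingFactorial_zero]
  | succ m ih =>
    rw [risingFactorial_succ, Nat.cast_succ, ← add_assoc, Real.Gamma_add_one (by positivity), ih]
    ring

theorem isProbabilityMeasure_gammaLaw {a : ℝ} (ha : 0 ≤ a) :
    IsProbabilityMeasure (gammaLaw a) := by
  unfold gammaLaw
  split_ifs with h
  · infer_instance
  · exact isProbabilityMeasure_gammaMeasure (lt_of_le_of_ne ha (Ne.symm h)) one_pos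

theorem measurable_gammaPDF (a r : ℝ) : Measurable (gammaPDF a r) :=
  (measurable_gammaPDFReal a r).ennreal_ofReal

theorem gammaLaw_ae_pos {a : ℝ} (ha : 0 < a) : ∀ᵐ x ∂gammaLaw a, 0 < x := by
  rw [gammaLaw, if_neg ha.ne', gammaMeasure, ae_withDensity_iff (measurable_gammaPDF a 1)]
  filter_upwards [Measure.ae_ne volume (0 : ℝ)] with x hx h
  by_contra hneg
  exact h (gammaPDF_of_neg (lt_of_le_of_ne (not_lt.1 hneg) hx))

theorem gammaLaw_ae_nonneg {a : ℝ} (ha : 0 ≤ a) : ∀ᵐ x ∂gammaLaw a, 0 ≤ x := by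
  rcases ha.eq_or_lt with rfl | h
  · simp [gammaLaw]
  · exact (gammaLaw_ae_pos h).mono fun _ => le_of_lt

/-- For `a > 0`, multiplying the Gamma(`a`, 1) density by `x^m e^{-sx}` gives a constant times the
Gamma(`a + m`, `1 + s`) density. For `a = 0` both sides are 1 if `m = 0` and 0 otherwise. -/
theorem lintegral_pow_mul_exp_gammaLaw {a : ℝ} (ha : 0 ≤ a) {s : ℝ} (hs : 0 ≤ s) (m : ℕ) :
    ∫⁻ x, ENNReal.ofReal (x ^ m * Real.exp (-(s * x))) ∂gammaLaw a =
      ENNReal.ofReal (risingFactorial a m * (1 + s) ^ (-(a + m))) := by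
  rcases ha.eq_or_lt with rfl | h
  · rw [gammaLaw, if_pos rfl, lintegral_dirac' _ (by fun_prop)]
    rcases m with _ | m
    · simp [risingFactorial_zero]
    · have : risingFactorial 0 (m + 1) = 0 :=
        Finset.prod_eq_zero (i := 0) (by simp) (by simp)
      simp [this]
  · rw [gammaLaw, if_neg h.ne', gammaMeasure, lintegral_withDensity_eq_lintegral_mul _
      (measurable_gammaPDF a 1) (by fun_prop)]
    have hs1 : 0 < 1 + s := by linarith
    have hm : 0 < a + m := by positivity
    have hG := Real.Gamma_pos_of_pos h
    have hR := risingFactorial_pos h m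
    have key : ∀ᵐ x : ℝ, (gammaPDF a 1 * fun x => ENNReal.ofReal (x ^ m * Real.exp (-(s * x)))) x =
        ENNReal.ofReal (risingFactorial a m * (1 + s) ^ (-(a + m))) *
          gammaPDF (a + m) (1 + s) x := by
      filter_upwards [Measure.ae_ne volume (0 : ℝ)] with x hx
      rw [Pi.mul_apply]
      rcases hx.lt_or_gt with hx | hx
      · simp [gammaPDF_of_neg hx]
      · rw [gammaPDF_of_nonneg hx.le, gammaPDF_of_nonneg hx.le,
          ← ENNReal.ofReal_mul (by positivity), ← ENNReal.ofReal_mul (by positivity)]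
        congr 1
        have e1 : x ^ (a + m - 1) = x ^ (a - 1) * x ^ m := by
          rw [← Real.rpow_natCast, ← Real.rpow_add hx]; congr 1; ring
        have e2 : Real.exp (-((1 + s) * x)) = Real.exp (-(1 * x)) * Real.exp (-(s * x)) := by
          rw [← Real.exp_add]; congr 1; ring
        have e3 : (1 + s) ^ (-(a + m)) * (1 + s) ^ (a + m) = 1 := by
          rw [← Real.rpow_add hs1]; simp
        rw [Gamma_add_natCast h, e1, e2, Real.one_rpow]
        field_simp
        linear_combination -e3
    rw [lintegral_congr_ae key, lintegral_const_mul _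
      (measurable_gammaPDF _ _), lintegral_gammaPDF_eq_one hm hs1, mul_one]

theorem integrable_pow_mul_exp_gammaLaw {a : ℝ} (ha : 0 ≤ a) {s : ℝ} (hs : 0 ≤ s) (m : ℕ) :
    Integrable (fun x => x ^ m * Real.exp (-(s * x))) (gammaLaw a) := by
  refine ⟨by fun_prop, ?_⟩
  rw [hasFiniteIntegral_iff_ofReal, lintegral_pow_mul_exp_gammaLaw ha hs]
  · exact ENNReal.ofReal_lt_top
  · filter_upwards [gammaLaw_ae_nonneg ha] with x hx
    simp only [Pi.zero_apply]
    positivity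

theorem integral_pow_mul_exp_gammaLaw {a : ℝ} (ha : 0 ≤ a) {s : ℝ} (hs : 0 ≤ s) (m : ℕ) :
    ∫ x, x ^ m * Real.exp (-(s * x)) ∂gammaLaw a =
      risingFactorial a m * (1 + s) ^ (-(a + m)) := by
  have h0 : 0 ≤ᵐ[gammaLaw a] fun x => x ^ m * Real.exp (-(s * x)) := by
    filter_upwards [gammaLaw_ae_nonneg ha] with x hx
    simp only [Pi.zero_apply]
    positivity
  rw [integral_eq_lintegral_of_nonneg_ae h0 (by fun_prop), lintegral_pow_mul_exp_gammaLaw ha hs,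
    ENNReal.toReal_ofReal]
  have := risingFactorial_nonneg ha m
  positivity

/-! ### Moments of the Dirichlet distribution. -/

section GammaProduct

variable {k : ℕ} {a : Fin k → ℝ}

theorem isProbabilityMeasure_pi_gammaLaw (ha : ∀ i, 0 ≤ a i) :
    IsProbabilityMeasure (Measure.pi fun i => gammaLaw (a i)) := by
  have := fun i => isProbabilityMeasure_gammaLaw (ha i)
  infer_instance

theorem pi_gammaLaw_ae_nonneg (ha : ∀ i, 0 ≤ a i) :
    ∀ᵐ g ∂Measure.pi fun i => gammaLaw (a i), ∀ i, 0 ≤ g i := by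
  have := fun i => isProbabilityMeasure_gammaLaw (ha i)
  rw [ae_all_iff]
  intro i
  exact (Measure.tendsto_eval_ae_ae (μ := fun i => gammaLaw (a i)) (i := i)).eventually
    (gammaLaw_ae_nonneg (ha i))

theorem pi_gammaLaw_ae_sum_pos (ha : ∀ i, 0 ≤ a i) (hpos : 0 < ∑ i, a i) :
    ∀ᵐ g ∂Measure.pi fun i => gammaLaw (a i), 0 < ∑ i, g i := by
  have := fun i => isProbabilityMeasure_gammaLaw (ha i)
  obtain ⟨i, -, hi⟩ := Finset.exists_lt_of_sum_lt (s := Finset.univ) (f := fun _ : Fin k => (0 : ℝ))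
    (g := a) (by simpa using hpos)
  filter_upwards [pi_gammaLaw_ae_nonneg ha,
    (Measure.tendsto_eval_ae_ae (μ := fun i => gammaLaw (a i)) (i := i)).eventually
      (gammaLaw_ae_pos hi)] with g hg hgi
  exact Finset.sum_pos' (fun i _ => hg i) ⟨i, Finset.mem_univ i, hgi⟩

/-- The moments of independent gamma variables under the exponential tilt by their sum. -/
theorem lintegral_prod_pow_mul_exp_pi_gammaLaw (ha : ∀ i, 0 ≤ a i) {s : ℝ} (hs : 0 ≤ s)
    (m : Fin k → ℕ) :
    ∫⁻ g, ENNReal.ofReal ((∏ i, g i ^ m i) * Real.exp (-(s * ∑ i, g i)))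
        ∂(Measure.pi fun i => gammaLaw (a i)) =
      ENNReal.ofReal ((∏ i, risingFactorial (a i) (m i)) *
        (1 + s) ^ (-(∑ i, a i + (∑ i, m i : ℕ)))) := by
  have := fun i => isProbabilityMeasure_gammaLaw (ha i)
  have e : ∀ g : Fin k → ℝ, (∏ i, g i ^ m i) * Real.exp (-(s * ∑ i, g i)) =
      ∏ i, (g i ^ m i * Real.exp (-(s * g i))) := fun g => by
    rw [Finset.prod_mul_distrib, ← Real.exp_sum, Finset.mul_sum, Finset.sum_neg_distrib]
  simp_rw [e]
  rw [← ofReal_integral_eq_lintegral_ofReal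
    (Integrable.fintype_prod fun i => integrable_pow_mul_exp_gammaLaw (ha i) hs (m i)),
    integral_fintype_prod_eq_prod (fun i x => x ^ m i * Real.exp (-(s * x)))]
  · simp_rw [integral_pow_mul_exp_gammaLaw (ha _) hs]
    rw [Finset.prod_mul_distrib, ← Real.rpow_sum_of_pos (by linarith), Finset.sum_neg_distrib,
      Finset.sum_add_distrib, Nat.cast_sum]
  · filter_upwards [pi_gammaLaw_ae_nonneg ha] with g hg
    exact Finset.prod_nonneg fun i _ => mul_nonneg (pow_nonneg (hg i) _) (Real.exp_pos _).le

/-- As a function of `s`, the integrand is the Gamma(`n + 1`, `x`) density up to the factor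
`x^{-(n+1)}`. This turns a negative power of the normalising sum into a mixture of exponentials,
which factor over independent coordinates. -/
theorem lintegral_pow_mul_exp_eq_inv_pow {x : ℝ} (hx : 0 < x) (n : ℕ) :
    ∫⁻ s in Set.Ici (0 : ℝ), ENNReal.ofReal (s ^ n / (n ! : ℝ) * Real.exp (-(s * x))) =
      ENNReal.ofReal ((x ^ (n + 1))⁻¹) := by
  have h1 := lintegral_gammaPDF_eq_one (a := n + 1) (r := x) (by positivity) hx
  have h2 : ∀ s ∈ Set.Ici (0 : ℝ), ENNReal.ofReal (s ^ n / (n ! : ℝ) * Real.exp (-(s * x))) =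
      ENNReal.ofReal ((x ^ (n + 1))⁻¹) * gammaPDF (n + 1) x s := by
    intro s hs
    rw [gammaPDF_of_nonneg hs, ← ENNReal.ofReal_mul (by positivity), Real.Gamma_nat_eq_factorial,
      add_sub_cancel_right, Real.rpow_natCast, ← Nat.cast_succ, Real.rpow_natCast, mul_comm s x]
    congr 1
    field_simp
  rw [setLIntegral_congr_fun measurableSet_Ici h2, lintegral_const_mul _
    (measurable_gammaPDF _ _)]
  have h3 : ∫⁻ s in Set.Iio (0 : ℝ), gammaPDF (n + 1) x s = 0 :=
    lintegral_gammaPDF_of_nonpos le_rfl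
  rw [← lintegral_add_compl _ (measurableSet_Ici (a := (0 : ℝ))), Set.compl_Ici, h3, add_zero] at h1
  rw [h1, mul_one]

theorem measurable_normalize :
    Measurable fun (g : Fin k → ℝ) i => g i / ∑ l, g l := by fun_prop

theorem isProbabilityMeasure_dirichletLaw (ha : ∀ i, 0 ≤ a i) :
    IsProbabilityMeasure (dirichletLaw a) := by
  have := isProbabilityMeasure_pi_gammaLaw ha
  exact Measure.isProbabilityMeasure_map measurable_normalize.aemeasurable

/-- No positive parameter is needed: where the normalising sum vanishes, `x / 0 = 0` still lies in
the interval. -/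
theorem dirichletLaw_ae_mem_Icc (ha : ∀ i, 0 ≤ a i) :
    ∀ᵐ p ∂dirichletLaw a, ∀ i, p i ∈ Set.Icc (0 : ℝ) 1 := by
  have hm : MeasurableSet {p : Fin k → ℝ | ∀ i, p i ∈ Set.Icc (0 : ℝ) 1} := by
    simp only [Set.ofPred_forall]
    exact MeasurableSet.iInter fun i => measurable_pi_apply i measurableSet_Icc
  rw [dirichletLaw, ae_map_iff measurable_normalize.aemeasurable hm]
  filter_upwards [pi_gammaLaw_ae_nonneg ha] with g hg i
  exact ⟨div_nonneg (hg i) (Finset.sum_nonneg fun j _ => hg j),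
    div_le_one_of_le₀ (Finset.single_le_sum (fun j _ => hg j) (Finset.mem_univ i))
      (Finset.sum_nonneg fun j _ => hg j)⟩

theorem dirichletLaw_ae_sum_eq_one (ha : ∀ i, 0 ≤ a i) (hpos : 0 < ∑ i, a i) :
    ∀ᵐ p ∂dirichletLaw a, ∑ i, p i = 1 := by
  rw [dirichletLaw, ae_map_iff measurable_normalize.aemeasurable
    (measurableSet_eq_fun (by fun_prop) (by fun_prop))]
  filter_upwards [pi_gammaLaw_ae_sum_pos ha hpos] with g hg
  rw [← Finset.sum_div, div_self hg.ne']

/-- Write the denominator `(∑ g_l)^{-(n+1)}` as an exponential mixture and apply Tonelli. The point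
is that the remaining integral depends only on `∑ a_i` and `n`. -/
theorem lintegral_prod_pow_dirichletLaw (ha : ∀ i, 0 ≤ a i) (hpos : 0 < ∑ i, a i)
    (m : Fin k → ℕ) {n : ℕ} (hm : ∑ i, m i = n + 1) :
    ∫⁻ p, ENNReal.ofReal (∏ i, p i ^ m i) ∂dirichletLaw a =
      ENNReal.ofReal (∏ i, risingFactorial (a i) (m i)) *
        ∫⁻ s in Set.Ici (0 : ℝ), ENNReal.ofReal
          (s ^ n / (n ! : ℝ) * (1 + s) ^ (-(∑ i, a i + (n + 1 : ℕ)))) := by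
  have := isProbabilityMeasure_pi_gammaLaw ha
  have hR : 0 ≤ ∏ i, risingFactorial (a i) (m i) :=
    Finset.prod_nonneg fun i _ => risingFactorial_nonneg (ha i) _
  rw [dirichletLaw, lintegral_map (by fun_prop) measurable_normalize]
  calc ∫⁻ g, ENNReal.ofReal (∏ i, (g i / ∑ l, g l) ^ m i) ∂(Measure.pi fun i => gammaLaw (a i))
      = ∫⁻ g, (∫⁻ s in Set.Ici (0 : ℝ), ENNReal.ofReal
          ((∏ i, g i ^ m i) * (s ^ n / (n ! : ℝ) * Real.exp (-(s * ∑ i, g i)))))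
          ∂(Measure.pi fun i => gammaLaw (a i)) := by
        refine lintegral_congr_ae ?_
        filter_upwards [pi_gammaLaw_ae_nonneg ha, pi_gammaLaw_ae_sum_pos ha hpos] with g hg hS
        have hP : 0 ≤ ∏ i, g i ^ m i := Finset.prod_nonneg fun i _ => pow_nonneg (hg i) _
        simp_rw [ENNReal.ofReal_mul hP]
        rw [lintegral_const_mul _ (by fun_prop), lintegral_pow_mul_exp_eq_inv_pow hS,
          ← ENNReal.ofReal_mul hP]
        simp_rw [div_pow]
        rw [Finset.prod_div_distrib, Finset.prod_pow_eq_pow_sum, hm, div_eq_mul_inv]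
    _ = ∫⁻ s in Set.Ici (0 : ℝ), (∫⁻ g, ENNReal.ofReal
          ((∏ i, g i ^ m i) * (s ^ n / (n ! : ℝ) * Real.exp (-(s * ∑ i, g i))))
          ∂(Measure.pi fun i => gammaLaw (a i))) := by
        rw [lintegral_lintegral_swap]
        fun_prop
    _ = ∫⁻ s in Set.Ici (0 : ℝ), ENNReal.ofReal (∏ i, risingFactorial (a i) (m i)) *
          ENNReal.ofReal (s ^ n / (n ! : ℝ) * (1 + s) ^ (-(∑ i, a i + (n + 1 : ℕ)))) := by
        refine setLIntegral_congr_fun measurableSet_Ici fun s hs => ?_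
        have hs : 0 ≤ s := hs
        have e : ∀ g : Fin k → ℝ, ENNReal.ofReal
            ((∏ i, g i ^ m i) * (s ^ n / (n ! : ℝ) * Real.exp (-(s * ∑ i, g i)))) =
            ENNReal.ofReal (s ^ n / (n ! : ℝ)) *
              ENNReal.ofReal ((∏ i, g i ^ m i) * Real.exp (-(s * ∑ i, g i))) := fun g => by
          rw [← ENNReal.ofReal_mul (by positivity)]; congr 1; ring
        simp_rw [e]
        rw [lintegral_const_mul _ (by fun_prop), lintegral_prod_pow_mul_exp_pi_gammaLaw ha hs, hm,
          ← ENNReal.ofReal_mul (by positivity), ← ENNReal.ofReal_mul hR]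
        congr 1; ring
    _ = _ := lintegral_const_mul _ (by fun_prop)

theorem integral_prod_pow_dirichletLaw (ha : ∀ i, 0 ≤ a i) (hpos : 0 < ∑ i, a i)
    (m : Fin k → ℕ) :
    ∫ p, ∏ i, p i ^ m i ∂dirichletLaw a =
      (∏ i, risingFactorial (a i) (m i)) / risingFactorial (∑ i, a i) (∑ i, m i) := by
  have key : ∀ {k : ℕ} {a : Fin k → ℝ}, (∀ i, 0 ≤ a i) → ∀ m : Fin k → ℕ,
      ∫ p, ∏ i, p i ^ m i ∂dirichletLaw a =
        (∫⁻ p, ENNReal.ofReal (∏ i, p i ^ m i) ∂dirichletLaw a).toReal := by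
    intro k a ha m
    refine integral_eq_lintegral_of_nonneg_ae ?_
      (Measurable.aestronglyMeasurable (by fun_prop))
    filter_upwards [dirichletLaw_ae_mem_Icc ha] with p hp
    exact Finset.prod_nonneg fun i _ => pow_nonneg (hp i).1 _
  have hR : 0 ≤ ∏ i, risingFactorial (a i) (m i) :=
    Finset.prod_nonneg fun i _ => risingFactorial_nonneg (ha i) _
  rcases hn : ∑ i, m i with _ | n
  · have := isProbabilityMeasure_dirichletLaw ha
    have hm : ∀ i, m i = 0 := by simpa using hn
    simp [hm, risingFactorial_zero]
  -- The beta-type integral is never computed: a single coordinate with the same total parameter is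
  -- almost surely 1, so its moment is 1 and the integral must be `1 / (∑ a_i)_{n+1}`.
  · have h1 := lintegral_prod_pow_dirichletLaw (k := 1) (a := fun _ => ∑ i, a i)
      (fun _ => hpos.le) (by simpa using hpos) (fun _ => n + 1) (n := n) (by simp)
    have h2 : ∫⁻ p, ENNReal.ofReal (∏ i : Fin 1, p i ^ (n + 1))
        ∂dirichletLaw (fun _ : Fin 1 => ∑ i, a i) = 1 := by
      have := isProbabilityMeasure_dirichletLaw (k := 1) (a := fun _ => ∑ i, a i) fun _ => hpos.le
      have h := dirichletLaw_ae_sum_eq_one (k := 1) (a := fun _ => ∑ i, a i)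
        (fun _ => hpos.le) (by simpa using hpos)
      rw [lintegral_congr_ae (g := fun _ => 1)]
      · simp
      · filter_upwards [h] with p hp
        simp only [Fin.sum_univ_one] at hp
        simp [hp]
    rw [h2] at h1
    simp only [Fin.prod_univ_one, Fin.sum_univ_one] at h1
    rw [key ha, lintegral_prod_pow_dirichletLaw ha hpos m hn, ENNReal.toReal_mul,
      ENNReal.toReal_ofReal hR, div_eq_mul_inv]
    congr 1
    have h3 := congrArg ENNReal.toReal h1
    rw [ENNReal.toReal_mul, ENNReal.toReal_ofReal (risingFactorial_nonneg hpos.le _),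
      ENNReal.toReal_one] at h3
    exact eq_inv_of_mul_eq_one_right h3.symm

end GammaProduct

/-! ### Generating functions: a product of binomial series as an exponential of power sums. -/

namespace PowerSeries

theorem coeff_prod_univ {R ι : Type*} [CommSemiring R] [Fintype ι] [DecidableEq ι]
    (f : ι → R⟦X⟧) (d : ℕ) :
    coeff d (∏ i, f i) = ∑ l ∈ Finset.piAntidiag Finset.univ d, ∏ i, coeff (l i) (f i) := by
  rw [coeff_prod]
  refine Finset.sum_equiv Finsupp.equivFunOnFinite ?_ ?_
  · intro l
    simp [Finset.mem_finsuppAntidiag]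
  · intro l _
    rfl

/-- Additivity of logarithmic derivatives, in a form free of division. -/
theorem derivative_prod_of_forall_eq_mul {R ι : Type*} [CommRing R] (s : Finset ι)
    {f g : ι → R⟦X⟧} (h : ∀ i ∈ s, derivative R (f i) = f i * g i) :
    derivative R (∏ i ∈ s, f i) = (∏ i ∈ s, f i) * ∑ i ∈ s, g i := by
  classical
  induction s using Finset.induction_on with
  | empty => simp
  | insert i s hi ih =>
    rw [Finset.prod_insert hi, Finset.sum_insert hi, Derivation.leibniz,
      ih fun j hj => h j (Finset.mem_insert_of_mem hj), h i (Finset.mem_insert_self i s)]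
    simp only [smul_eq_mul]
    ring

/-- Solutions of `A' = A L` with the same initial value agree up to order `n` if the right-hand
sides `L` agree below order `n`. -/
theorem coeff_eq_of_derivative_eq_mul {A B L M : ℂ⟦X⟧} {n : ℕ}
    (hA : derivative ℂ A = A * L) (hB : derivative ℂ B = B * M)
    (hLM : ∀ j < n, coeff j L = coeff j M) (h0 : coeff 0 A = coeff 0 B) :
    ∀ m ≤ n, coeff m A = coeff m B := by
  intro m
  induction m using Nat.strong_induction_on with
  | _ m ih =>
    intro hm
    rcases m with _ | m
    · exact h0
    · have h1 := congrArg (coeff m) hA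
      have h2 := congrArg (coeff m) hB
      rw [coeff_derivative, coeff_mul] at h1 h2
      have h3 : coeff (m + 1) A * ((m : ℂ) + 1) = coeff (m + 1) B * ((m : ℂ) + 1) := by
        rw [h1, h2]
        refine Finset.sum_congr rfl fun p hp => ?_
        have := Finset.HasAntidiagonal.mem_antidiagonal.1 hp
        rw [ih p.1 (by omega) (by omega), hLM p.2 (by omega)]
      exact mul_right_cancel₀ (Nat.cast_add_one_ne_zero m) h3

/-- The binomial series `(1 - c X) ^ (-a)`. -/
noncomputable def negBinomialSeries (a : ℝ) (c : ℂ) : ℂ⟦X⟧ :=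
  mk fun m => (risingFactorial a m : ℂ) / (m ! : ℂ) * c ^ m

/-- The logarithmic derivative is `a c / (1 - c X)`; both sides are compared after multiplication by
the nonzero series `1 - c X`. -/
theorem derivative_negBinomialSeries (a : ℝ) (c : ℂ) :
    derivative ℂ (negBinomialSeries a c) =
      negBinomialSeries a c * mk fun j => (a : ℂ) * c ^ (j + 1) := by
  have h1 : (mk fun j => (a : ℂ) * c ^ (j + 1)) * (1 - C c * X) = C ((a : ℂ) * c) := by
    ext n
    rcases n with _ | n
    · simp [mul_sub]
    · rw [mul_sub, mul_one, mul_left_comm, ← mul_assoc, map_sub, coeff_succ_mul_X, coeff_C_mul]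
      simp
      ring
  have h2 : derivative ℂ (negBinomialSeries a c) * (1 - C c * X) =
      C ((a : ℂ) * c) * negBinomialSeries a c := by
    ext n
    rcases n with _ | n
    · have h := coeff_derivative (negBinomialSeries a c) 0
      simp only [negBinomialSeries, coeff_mk, risingFactorial_succ, risingFactorial_zero] at h
      simp at h
      simp [mul_sub, negBinomialSeries, risingFactorial_zero, h]
    · have hn' : ((n ! : ℕ) : ℂ) ≠ 0 := by exact_mod_cast n.factorial_ne_zero
      have hn1 : (n : ℂ) + 1 ≠ 0 := Nat.cast_add_one_ne_zero n
      have hn2 : (n : ℂ) + 1 + 1 ≠ 0 := by exact_mod_cast Nat.succ_ne_zero (n + 1)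
      rw [mul_sub, mul_one, mul_left_comm, ← mul_assoc, map_sub, coeff_succ_mul_X, coeff_C_mul,
        coeff_derivative, coeff_derivative, coeff_C_mul]
      simp only [negBinomialSeries, coeff_mk, risingFactorial_succ, Nat.factorial_succ]
      push_cast
      field_simp
      ring
  have h3 : (1 - C c * X : ℂ⟦X⟧) ≠ 0 := fun h => by
    simpa using congrArg (coeff 0) h
  refine mul_right_cancel₀ h3 ?_
  rw [h2, mul_assoc, h1, mul_comm]

/-- The series `exp (q X ^ (j + 1))`. -/
noncomputable def expMonomialSeries (j : ℕ) (q : ℂ) : ℂ⟦X⟧ :=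
  mk fun l => if (j + 1) ∣ l then q ^ (l / (j + 1)) / ((l / (j + 1))! : ℂ) else 0

theorem derivative_expMonomialSeries (j : ℕ) (q : ℂ) :
    derivative ℂ (expMonomialSeries j q) =
      expMonomialSeries j q * (C (((j : ℂ) + 1) * q) * X ^ j) := by
  ext l
  rw [← mul_assoc, coeff_mul_X_pow', coeff_derivative, mul_comm _ (C _), coeff_C_mul]
  simp only [expMonomialSeries, coeff_mk]
  by_cases hd : (j + 1) ∣ l + 1
  · obtain ⟨r, hr⟩ := hd
    rcases r with _ | r
    · simp at hr
    -- The only degrees in which the derivative has a nonzero coefficient.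
    have hl : l = (j + 1) * r + j := by
      have : (j + 1) * (r + 1) = (j + 1) * r + j + 1 := by ring
      omega
    subst hl
    have hr0 : ((r ! : ℕ) : ℂ) ≠ 0 := by exact_mod_cast r.factorial_ne_zero
    have hr1 : (r : ℂ) + 1 ≠ 0 := Nat.cast_add_one_ne_zero r
    rw [if_pos (Dvd.intro _ hr.symm), if_pos (Nat.le_add_left _ _), hr,
      Nat.mul_div_cancel_left _ (by simp),
      Nat.add_sub_cancel, if_pos (Dvd.intro _ rfl), Nat.mul_div_cancel_left _ (by simp),
      Nat.factorial_succ]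
    push_cast
    field_simp
    ring
  · rw [if_neg hd, zero_mul]
    split_ifs with h1 h2
    · refine absurd ?_ hd
      have : l + 1 = (l - j) + (j + 1) := by omega
      rw [this]
      exact dvd_add h2 dvd_rfl
    · simp
    · rfl

theorem coeff_prod_expMonomialSeries (n : ℕ) (q : Fin n → ℂ) :
    coeff n (∏ j : Fin n, expMonomialSeries j (q j)) =
      ∑ v ∈ partitionVectors n, ∏ j, q j ^ v j / ((v j)! : ℂ) := by
  rw [coeff_prod_univ]
  symm
  refine Finset.sum_of_injOn (fun v j => (j.val + 1) * v j) ?_ ?_ ?_ ?_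
  · intro v _ w _ h
    funext j
    exact Nat.eq_of_mul_eq_mul_left (Nat.succ_pos j.val) (congrFun h j)
  · intro v hv
    simpa [mem_partitionVectors] using hv
  -- A nonzero term forces `j + 1` to divide `l j` for every `j`, so `l` comes from the vector of
  -- quotients.
  · intro l hl hnot
    by_contra hne
    apply hnot
    have hd : ∀ j : Fin n, (j.val + 1) ∣ l j := by
      intro j
      by_contra hj
      exact hne (Finset.prod_eq_zero (Finset.mem_univ j) (by simp [expMonomialSeries, hj]))
    refine ⟨fun j => l j / (j.val + 1), ?_, ?_⟩
    · have hl' : ∑ j, l j = n := by simpa using hl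
      simp only [Finset.mem_coe, mem_partitionVectors]
      exact (Finset.sum_congr rfl fun j _ => Nat.mul_div_cancel' (hd j)).trans hl'
    · funext j
      exact Nat.mul_div_cancel' (hd j)
  · intro v _
    refine Finset.prod_congr rfl fun j _ => ?_
    simp [expMonomialSeries]

/-- The coefficients of `∏ i, (1 - c i X) ^ (-a i)` in terms of the power sums
`∑ i, a i * c i ^ j`. -/
theorem coeff_prod_negBinomialSeries {k : ℕ} (a : Fin k → ℝ) (c : Fin k → ℂ) (n : ℕ) :
    coeff n (∏ i, negBinomialSeries (a i) (c i)) =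
      ∑ v ∈ partitionVectors n, ∏ j : Fin n,
        ((∑ i, (a i : ℂ) * c i ^ (j.val + 1)) / ((j : ℂ) + 1)) ^ v j / ((v j)! : ℂ) := by
  rw [← coeff_prod_expMonomialSeries n
    fun j => (∑ i, (a i : ℂ) * c i ^ (j.val + 1)) / ((j : ℂ) + 1)]
  -- In each degree `l < n` both logarithmic derivatives have coefficient `∑ a_i c_i^(l+1)`. The
  -- exponential product has only `n` factors, so agreement is claimed only up to order `n`.
  refine coeff_eq_of_derivative_eq_mul (n := n)
    (derivative_prod_of_forall_eq_mul _ fun i _ => derivative_negBinomialSeries (a i) (c i))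
    (derivative_prod_of_forall_eq_mul _ fun j _ => derivative_expMonomialSeries _ _) ?_ ?_ n le_rfl
  · intro l hl
    simp only [map_sum, coeff_mk, coeff_C_mul, coeff_X_pow]
    rw [Finset.sum_eq_single (⟨l, hl⟩ : Fin n)]
    · have : (l : ℂ) + 1 ≠ 0 := Nat.cast_add_one_ne_zero l
      simp only [if_true, mul_one]
      field_simp
    · intro j _ hj
      rw [if_neg fun h => hj (Fin.ext h.symm), mul_zero]
    · simp
  · simp only [coeff_zero_eq_constantCoeff, map_prod]
    simp [← coeff_zero_eq_constantCoeff_apply, negBinomialSeries, expMonomialSeries,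
      risingFactorial_zero]

end PowerSeries

/-- In the multinomial expansion, `multinomial m * ∏ (a_i)_{m_i} c_i^{m_i}` is `n!` times a product
of coefficients of the binomial series, so the sum over `m` is a coefficient of their product. -/
theorem integral_sum_mul_pow_dirichletLaw {k : ℕ} {a : Fin k → ℝ} (ha : ∀ i, 0 ≤ a i)
    (hpos : 0 < ∑ i, a i) (c : Fin k → ℂ) (n : ℕ) :
    ∫ p, (∑ i, c i * (p i : ℂ)) ^ n ∂dirichletLaw a =
      (n ! : ℂ) / (risingFactorial (∑ i, a i) n : ℂ) *
        ∑ v ∈ partitionVectors n, ∏ j : Fin n,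
          ((∑ i, (a i : ℂ) * c i ^ (j.val + 1)) / ((j : ℂ) + 1)) ^ v j / ((v j)! : ℂ) := by
  have := isProbabilityMeasure_dirichletLaw ha
  rw [← PowerSeries.coeff_prod_negBinomialSeries, PowerSeries.coeff_prod_univ]
  simp_rw [Finset.sum_pow_eq_sum_piAntidiag]
  have hint : ∀ m : Fin k → ℕ, Integrable (fun p : Fin k → ℝ => ∏ i, p i ^ m i)
      (dirichletLaw a) := fun m => by
    refine Integrable.of_bound (Measurable.aestronglyMeasurable (by fun_prop)) 1 ?_
    filter_upwards [dirichletLaw_ae_mem_Icc ha] with p hp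
    rw [Real.norm_eq_abs, Finset.abs_prod]
    refine Finset.prod_le_one (fun i _ => abs_nonneg _) fun i _ => ?_
    rw [abs_pow, abs_of_nonneg (hp i).1]
    exact pow_le_one₀ (hp i).1 (hp i).2
  have e : ∀ (m : Fin k → ℕ) (p : Fin k → ℝ),
      (Nat.multinomial Finset.univ m : ℂ) * ∏ i, (c i * (p i : ℂ)) ^ m i =
        ((Nat.multinomial Finset.univ m : ℂ) * ∏ i, c i ^ m i) * ((∏ i, p i ^ m i : ℝ) : ℂ) := by
    intro m p
    push_cast
    simp_rw [mul_pow]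
    rw [Finset.prod_mul_distrib, mul_assoc]
  simp_rw [e]
  rw [integral_finsetSum _ fun m _ => (hint m).ofReal.const_mul _, Finset.mul_sum]
  refine Finset.sum_congr rfl fun m hm => ?_
  have hm' : ∑ i, m i = n := by simpa using hm
  rw [integral_const_mul, integral_complex_ofReal, integral_prod_pow_dirichletLaw ha hpos, hm']
  simp only [PowerSeries.negBinomialSeries, PowerSeries.coeff_mk]
  have hs : (∏ i, ((m i)! : ℂ)) * (Nat.multinomial Finset.univ m : ℂ) = (n ! : ℂ) := by
    rw [← hm', ← Nat.multinomial_spec]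
    push_cast
    rfl
  have h0 : (∏ i, ((m i)! : ℂ)) ≠ 0 :=
    Finset.prod_ne_zero_iff.2 fun i _ => by exact_mod_cast (m i).factorial_ne_zero
  rw [Finset.prod_mul_distrib, Finset.prod_div_distrib, ← hs]
  push_cast
  field_simp

/-! ### Conditionally i.i.d. samples from a Dirichlet process. -/

section CondIID

variable {Ω S : Type*} [MeasurableSpace Ω] [MeasurableSpace S] {P : Measure Ω}
  {F : Ω → ProbabilityMeasure S} {T : ℕ → Ω → S}

theorem IsCondIID.measurableSet_forall_mem (hT : IsCondIID T F P) {n : ℕ} {A : Fin n → Set S}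
    (hA : ∀ i, MeasurableSet (A i)) : MeasurableSet {ω | ∀ i : Fin n, T i ω ∈ A i} := by
  rw [Set.ofPred_forall]
  exact MeasurableSet.iInter fun i => hT.measurable i (hA i)

variable [IsProbabilityMeasure P]

theorem IsCondIID.measureReal_forall_mem (hT : IsCondIID T F P) (hF : Measurable F) {n : ℕ}
    {A : Fin n → Set S} (hA : ∀ i, MeasurableSet (A i)) :
    P.real {ω | ∀ i : Fin n, T i ω ∈ A i} = ∫ ω, ∏ i, (F ω : Measure S).real (A i) ∂P := by
  have hm := hT.measurableSet_forall_mem hA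
  rw [← integral_congr_ae (hT.condProb n A hA), integral_condExp hF.comap_le,
    integral_indicator hm]
  simp [Measure.real]

theorem integrable_prod_measureReal (hF : Measurable F) {n : ℕ}
    {A : Fin n → Set S} (hA : ∀ i, MeasurableSet (A i)) :
    Integrable (fun ω => ∏ i, (F ω : Measure S).real (A i)) P := by
  refine Integrable.of_bound (Measurable.aestronglyMeasurable ?_) 1 (.of_forall fun ω => ?_)
  · refine Finset.measurable_prod _ fun i _ => ?_
    exact ((Measure.measurable_coe (hA i)).comp (measurable_subtype_coe.comp hF)).ennreal_toReal
  · rw [Real.norm_eq_abs, abs_of_nonneg (Finset.prod_nonneg fun i _ => measureReal_nonneg)]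
    exact Finset.prod_le_one (fun i _ => measureReal_nonneg) fun i _ => measureReal_le_one

/-- Both sides expand over the maps `κ` assigning a cell to each sample point; the terms agree by
integrating out the conditional probability. -/
theorem IsCondIID.integral_prod_sum_indicator (hT : IsCondIID T F P) (hF : Measurable F) {k : ℕ}
    {B : Fin k → Set S} (hB : ∀ i, MeasurableSet (B i)) (c : Fin k → ℂ) (n : ℕ) :
    ∫ ω, ∏ i : Fin n, ∑ l, (B l).indicator (fun _ => c l) (T i ω) ∂P =
      ∫ ω, (∑ l, c l * ((F ω : Measure S).real (B l) : ℂ)) ^ n ∂P := by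
  have e1 : ∀ ω, ∏ i : Fin n, ∑ l, (B l).indicator (fun _ => c l) (T i ω) =
      ∑ κ : Fin n → Fin k, {ω | ∀ i : Fin n, T i ω ∈ B (κ i)}.indicator
        (fun _ => ∏ i, c (κ i)) ω := by
    intro ω
    rw [Finset.prod_univ_sum, Fintype.piFinset_univ]
    refine Finset.sum_congr rfl fun κ _ => ?_
    by_cases h : ∀ i : Fin n, T i ω ∈ B (κ i)
    · rw [Set.indicator_of_mem (by exact h)]
      exact Finset.prod_congr rfl fun i _ => Set.indicator_of_mem (h i) _
    · rw [Set.indicator_of_notMem (by exact h)]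
      obtain ⟨i, hi⟩ := not_forall.1 h
      exact Finset.prod_eq_zero (Finset.mem_univ i) (Set.indicator_of_notMem hi _)
  have e2 : ∀ ω, (∑ l, c l * ((F ω : Measure S).real (B l) : ℂ)) ^ n =
      ∑ κ : Fin n → Fin k, (∏ i, c (κ i)) *
        ((∏ i, (F ω : Measure S).real (B (κ i)) : ℝ) : ℂ) := by
    intro ω
    have := Finset.prod_univ_sum (fun _ : Fin n => (Finset.univ : Finset (Fin k)))
      (fun _ l => c l * ((F ω : Measure S).real (B l) : ℂ))
    rw [Finset.prod_const, Finset.card_univ, Fintype.card_fin] at this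
    rw [this, Fintype.piFinset_univ]
    refine Finset.sum_congr rfl fun κ _ => ?_
    rw [Finset.prod_mul_distrib]
    push_cast
    rfl
  simp_rw [e1, e2]
  rw [integral_finsetSum, integral_finsetSum]
  · refine Finset.sum_congr rfl fun κ _ => ?_
    rw [integral_const_mul, integral_complex_ofReal,
      ← hT.measureReal_forall_mem hF fun i => hB (κ i),
      integral_indicator_const _ (hT.measurableSet_forall_mem fun i => hB (κ i)),
      Complex.real_smul, mul_comm]
  · exact fun κ _ => (integrable_prod_measureReal hF fun i => hB (κ i)).ofReal.const_mul _
  · exact fun κ _ => (integrable_const _).indicator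
      (hT.measurableSet_forall_mem fun i => hB (κ i))

theorem IsCondIID.integral_prod_simpleFunc (hT : IsCondIID T F P) {α : ℝ} (hα : 0 < α)
    {H : Measure S} [IsProbabilityMeasure H] (hF : IsDirichletProcess F α H P)
    (g : SimpleFunc S ℂ) (n : ℕ) :
    ∫ ω, ∏ i : Fin n, g (T i ω) ∂P =
      (n ! : ℂ) / (risingFactorial α n : ℂ) *
        ∑ v ∈ partitionVectors n, ∏ j : Fin n,
          ((α : ℂ) * (∫ x, g x ^ (j.val + 1) ∂H) / ((j : ℂ) + 1)) ^ v j / ((v j)! : ℂ) := by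
  -- The level sets of `g` form the partition to which the Dirichlet property is applied.
  let e := g.range.equivFin.symm
  let B : Fin g.range.card → Set S := fun i => g ⁻¹' {(e i : ℂ)}
  have hB : ∀ i, MeasurableSet (B i) := fun i => g.measurableSet_fiber _
  have hg : ∀ (h : ℂ → ℂ) (x : S), h (g x) = ∑ i, (B i).indicator (fun _ => h (e i)) x := by
    intro h x
    have hx : ((e (e.symm ⟨g x, g.mem_range_self x⟩) : g.range) : ℂ) = g x := by simp
    rw [Finset.sum_eq_single (e.symm ⟨g x, g.mem_range_self x⟩)]
    · rw [Set.indicator_of_mem (by simp [B]), hx]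
    · intro i _ hi
      refine Set.indicator_of_notMem (fun hxi => hi ?_) _
      have hxi : g x = e i := hxi
      rw [Equiv.eq_symm_apply]
      exact Subtype.ext hxi.symm
    · simp
  have hint : ∀ h : ℂ → ℂ, ∫ x, h (g x) ∂H = ∑ i, (H.real (B i) : ℂ) * h (e i) := by
    intro h
    simp_rw [hg h]
    rw [integral_finsetSum _ fun i _ => (integrable_const _).indicator (hB i)]
    simp_rw [integral_indicator_const _ (hB _), Complex.real_smul]
  have hsum : ∑ i, α * H.real (B i) = α := by
    have := hint fun _ => 1
    simp only [integral_const, mul_one, probReal_univ, one_smul] at this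
    rw [← Finset.mul_sum, ← mul_one α]
    congr 1
    · simp
    · exact_mod_cast this.symm
  have hlaw := hF.hasLaw _ B hB
    (fun i j hij => Set.disjoint_left.2 fun x hi hj => hij (e.injective (Subtype.ext
      ((show g x = e i from hi).symm.trans hj))))
    (Set.eq_univ_of_forall fun x => Set.mem_iUnion.2
      ⟨e.symm ⟨g x, g.mem_range_self x⟩, by simp [B]⟩)
  have hdir := integral_sum_mul_pow_dirichletLaw (a := fun i => α * H.real (B i))
    (fun i => by positivity) (by rw [hsum]; exact hα) (fun i => (e i : ℂ)) n
  rw [hsum, ← hlaw.map_eq, integral_map hlaw.aemeasurable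
    (Measurable.aestronglyMeasurable (by fun_prop))] at hdir
  have h1 := hT.integral_prod_sum_indicator hF.measurable hB (fun i => (e i : ℂ)) n
  simp_rw [hg fun z => z]
  rw [h1, hdir]
  congr 1
  refine Finset.sum_congr rfl fun v _ => Finset.prod_congr rfl fun j _ => ?_
  have h2 := hint fun z => z ^ (j.val + 1)
  -- Restores `g` inside the integrals over `H`, where it was also expanded into indicators.
  simp_rw [← hg fun z => z]
  rw [h2, Finset.mul_sum]
  push_cast
  simp_rw [mul_assoc]

/-- The law of a conditionally i.i.d. sample from a Dirichlet process, integrated against a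
product of copies of a bounded function. -/
theorem IsCondIID.integral_prod_of_norm_le (hT : IsCondIID T F P) {α : ℝ} (hα : 0 < α)
    {H : Measure S} [IsProbabilityMeasure H] (hF : IsDirichletProcess F α H P)
    {f : S → ℂ} (hf : StronglyMeasurable f) (hf1 : ∀ x, ‖f x‖ ≤ 1) (n : ℕ) :
    ∫ ω, ∏ i : Fin n, f (T i ω) ∂P =
      (n ! : ℂ) / (risingFactorial α n : ℂ) *
        ∑ v ∈ partitionVectors n, ∏ j : Fin n,
          ((α : ℂ) * (∫ x, f x ^ (j.val + 1) ∂H) / ((j : ℂ) + 1)) ^ v j / ((v j)! : ℂ) := by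
  let g := hf.approxBounded 1
  have hg : ∀ x, Filter.Tendsto (fun m => g m x) Filter.atTop (nhds (f x)) := fun x =>
    hf.tendsto_approxBounded_of_norm_le (hf1 x)
  have hg1 : ∀ m x, ‖g m x‖ ≤ 1 := hf.norm_approxBounded_le zero_le_one
  have hl : Filter.Tendsto (fun m => ∫ ω, ∏ i : Fin n, g m (T i ω) ∂P) Filter.atTop
      (nhds (∫ ω, ∏ i : Fin n, f (T i ω) ∂P)) := by
    refine tendsto_integral_of_dominated_convergence (fun _ => 1) (fun m => ?_)
      (integrable_const _) (fun m => .of_forall fun ω => ?_) (.of_forall fun ω => ?_)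
    · exact (Finset.measurable_prod Finset.univ fun (i : Fin n) _ =>
        (g m).measurable.comp (hT.measurable i)).aestronglyMeasurable
    · rw [norm_prod]
      exact Finset.prod_le_one (fun i _ => norm_nonneg _) fun i _ => hg1 _ _
    · exact tendsto_finsetProd _ fun i _ => hg _
  have hr : ∀ j : ℕ, Filter.Tendsto (fun m => ∫ x, g m x ^ (j + 1) ∂H) Filter.atTop
      (nhds (∫ x, f x ^ (j + 1) ∂H)) := by
    intro j
    refine tendsto_integral_of_dominated_convergence (fun _ => 1) (fun m => ?_)
      (integrable_const _) (fun m => .of_forall fun ω => ?_) (.of_forall fun ω => ?_)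
    · exact ((g m).measurable.pow_const _).aestronglyMeasurable
    · rw [norm_pow]
      exact pow_le_one₀ (norm_nonneg _) (hg1 _ _)
    · exact (hg _).pow _
  -- The right-hand side is a polynomial in finitely many integrals `∫ f^j dH`, hence continuous
  -- under the approximation.
  refine tendsto_nhds_unique hl ?_
  simp_rw [hT.integral_prod_simpleFunc hα hF]
  refine Filter.Tendsto.const_mul _ (tendsto_finsetSum _ fun v _ => tendsto_finsetProd _
    fun j _ => ?_)
  exact ((((hr j).const_mul _).div_const _).pow _).div_const _

end CondIID

/-! ### Characteristic functions of scaled laws and convolutions. -/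

/-- The characteristic function of a distribution on `[0, ∞)`. -/
noncomputable def nnCharFun (μ : Measure ℝ≥0) (θ : ℝ) : ℂ :=
  ∫ x : ℝ≥0, Complex.exp (θ * (x : ℝ) * Complex.I) ∂μ

theorem charFun_map_coe (μ : Measure ℝ≥0) (θ : ℝ) :
    charFun (μ.map ((↑) : ℝ≥0 → ℝ)) θ = nnCharFun μ θ := by
  rw [charFun_apply_real, integral_map (by fun_prop) (by fun_prop)]
  rfl

theorem nnCharFun_dirac_zero (θ : ℝ) : nnCharFun (Measure.dirac 0) θ = 1 := by
  simp [nnCharFun]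

theorem nnCharFun_conv (μ ν : Measure ℝ≥0) [IsFiniteMeasure μ] [IsFiniteMeasure ν] (θ : ℝ) :
    nnCharFun (μ.conv ν) θ = nnCharFun μ θ * nnCharFun ν θ := by
  have := Measure.map_conv_addMonoidHom (μ := μ) (ν := ν) (NNReal.toRealHom : ℝ≥0 →+ ℝ)
    measurable_coe_nnreal_real
  have h : (μ.conv ν).map ((↑) : ℝ≥0 → ℝ) =
      (μ.map ((↑) : ℝ≥0 → ℝ)).conv (ν.map ((↑) : ℝ≥0 → ℝ)) := this
  rw [← charFun_map_coe, h, charFun_conv, charFun_map_coe, charFun_map_coe]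

instance isProbabilityMeasure_convPow (μ : Measure ℝ≥0) [IsProbabilityMeasure μ] (m : ℕ) :
    IsProbabilityMeasure (convPow μ m) := by
  induction m with
  | zero => exact Measure.dirac.isProbabilityMeasure
  | succ m ih => exact inferInstanceAs (IsProbabilityMeasure ((convPow μ m).conv μ))

theorem nnCharFun_convPow (μ : Measure ℝ≥0) [IsProbabilityMeasure μ] (m : ℕ) (θ : ℝ) :
    nnCharFun (convPow μ m) θ = nnCharFun μ θ ^ m := by
  induction m with
  | zero => simp [convPow, nnCharFun_dirac_zero]
  | succ m ih => rw [convPow, nnCharFun_conv, ih, pow_succ]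

instance isProbabilityMeasure_scaledLaw (H : Measure ℝ≥0) [IsProbabilityMeasure H] (j : ℕ) :
    IsProbabilityMeasure (scaledLaw H j) :=
  Measure.isProbabilityMeasure_map (by fun_prop)

theorem nnCharFun_scaledLaw (H : Measure ℝ≥0) (j : ℕ) (θ : ℝ) :
    nnCharFun (scaledLaw H j) θ =
      ∫ x : ℝ≥0, Complex.exp (θ * (x : ℝ) * Complex.I) ^ j ∂H := by
  rw [nnCharFun, scaledLaw, integral_map (by fun_prop) (by fun_prop)]
  refine integral_congr_ae (.of_forall fun x => ?_)
  simp only [← Complex.exp_nat_mul]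
  congr 1
  push_cast
  ring

/-- The claims go through one induction because multiplicativity under convolution needs the tail to
be finite. -/
theorem isProbabilityMeasure_and_nnCharFun_foldr_conv (l : List (Measure ℝ≥0))
    (hl : ∀ μ ∈ l, IsProbabilityMeasure μ) (θ : ℝ) :
    IsProbabilityMeasure (l.foldr Measure.conv (Measure.dirac 0)) ∧
      nnCharFun (l.foldr Measure.conv (Measure.dirac 0)) θ =
        (l.map fun μ => nnCharFun μ θ).prod := by
  induction l with
  | nil => exact ⟨Measure.dirac.isProbabilityMeasure, by simp [nnCharFun_dirac_zero]⟩
  | cons μ l ih =>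
    obtain ⟨h1, h2⟩ := ih fun ν hν => hl ν (List.mem_cons_of_mem _ hν)
    have := hl μ List.mem_cons_self
    refine ⟨inferInstanceAs (IsProbabilityMeasure (μ.conv _)), ?_⟩
    rw [List.foldr_cons, nnCharFun_conv, h2, List.map_cons, List.prod_cons]

section PartitionConv

variable (H : Measure ℝ≥0) [IsProbabilityMeasure H]

theorem isProbabilityMeasure_and_nnCharFun_partitionConv {n : ℕ} (v : Fin n → ℕ) (θ : ℝ) :
    IsProbabilityMeasure (partitionConv H v) ∧
      nnCharFun (partitionConv H v) θ = ∏ j : Fin n,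
        (∫ x : ℝ≥0, Complex.exp (θ * (x : ℝ) * Complex.I) ^ (j.val + 1) ∂H) ^ v j := by
  have h := isProbabilityMeasure_and_nnCharFun_foldr_conv
    (List.ofFn fun j : Fin n => convPow (scaledLaw H (j + 1)) (v j))
    (fun μ hμ => by
      obtain ⟨j, rfl⟩ := List.mem_ofFn.1 hμ
      infer_instance) θ
  refine ⟨h.1, h.2.trans ?_⟩
  rw [List.map_ofFn, List.prod_ofFn]
  refine Finset.prod_congr rfl fun j _ => ?_
  simp only [Function.comp_apply]
  rw [nnCharFun_convPow, nnCharFun_scaledLaw]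

instance isProbabilityMeasure_partitionConv {n : ℕ} (v : Fin n → ℕ) :
    IsProbabilityMeasure (partitionConv H v) :=
  (isProbabilityMeasure_and_nnCharFun_partitionConv H v 0).1

theorem nnCharFun_partitionConv {n : ℕ} (v : Fin n → ℕ) (θ : ℝ) :
    nnCharFun (partitionConv H v) θ = ∏ j : Fin n,
      (∫ x : ℝ≥0, Complex.exp (θ * (x : ℝ) * Complex.I) ^ (j.val + 1) ∂H) ^ v j :=
  (isProbabilityMeasure_and_nnCharFun_partitionConv H v θ).2

end PartitionConv

/-- The weight of the partition of `n` with `v j` parts equal to `j + 1`. -/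
noncomputable def partitionWeight (α : ℝ) {n : ℕ} (v : Fin n → ℕ) : ℝ :=
  (n ! : ℝ) / risingFactorial α n *
    ∏ j : Fin n, α ^ v j / (((j : ℝ) + 1) ^ v j * ((v j)! : ℝ))

theorem partitionWeight_nonneg {α : ℝ} (hα : 0 < α) {n : ℕ} (v : Fin n → ℕ) :
    0 ≤ partitionWeight α v := by
  have := risingFactorial_pos hα n
  exact mul_nonneg (by positivity) (Finset.prod_nonneg fun j _ => by positivity)

theorem nnCharFun_sum_smul {ι : Type*} (s : Finset ι) {w : ι → ℝ} (hw : ∀ i ∈ s, 0 ≤ w i)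
    (μ : ι → Measure ℝ≥0) [∀ i, IsFiniteMeasure (μ i)] (θ : ℝ) :
    nnCharFun (∑ i ∈ s, ENNReal.ofReal (w i) • μ i) θ = ∑ i ∈ s, (w i : ℂ) * nnCharFun (μ i) θ := by
  rw [nnCharFun, integral_finsetSum_measure]
  · refine Finset.sum_congr rfl fun i hi => ?_
    rw [integral_smul_measure, ENNReal.toReal_ofReal (hw i hi), Complex.real_smul]
    rfl
  · intro i _
    refine Integrable.smul_measure (Integrable.of_bound (by fun_prop) 1 (.of_forall fun x => ?_))
      ENNReal.ofReal_ne_top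
    rw [← Complex.ofReal_mul, Complex.norm_exp_ofReal_mul_I]

theorem measure_ext_of_nnCharFun {μ ν : Measure ℝ≥0} [IsFiniteMeasure μ] [IsFiniteMeasure ν]
    (h : ∀ θ, nnCharFun μ θ = nnCharFun ν θ) : μ = ν := by
  have h1 : μ.map ((↑) : ℝ≥0 → ℝ) = ν.map ((↑) : ℝ≥0 → ℝ) :=
    Measure.ext_of_charFun (funext fun θ => by rw [charFun_map_coe, charFun_map_coe, h])
  -- Uniqueness holds on `ℝ`; `Real.toNNReal`, a left inverse of the inclusion, brings it back.
  have h2 := congrArg (Measure.map Real.toNNReal) h1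
  have h3 : Real.toNNReal ∘ ((↑) : ℝ≥0 → ℝ) = id := funext fun x => Real.toNNReal_coe
  rwa [Measure.map_map (by fun_prop) (by fun_prop), Measure.map_map (by fun_prop) (by fun_prop),
    h3, Measure.map_id, Measure.map_id] at h2

/-! ### The renewal process as a sum of indicators. -/

theorem measurable_addingProcess {Ω : Type*} [MeasurableSpace Ω] {T : ℕ → Ω → ℝ≥0}
    (hT : ∀ i, Measurable (T i)) (n : ℕ) :
    Measurable (addingProcess T n) :=
  Finset.measurable_sum (Finset.range n) fun i _ => hT i

theorem addingProcess_mono {Ω : Type*} {T : ℕ → Ω → ℝ≥0} (ω : Ω) :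
    Monotone fun n => addingProcess T n ω :=
  fun _ _ h => Finset.sum_le_sum_of_subset (Finset.range_mono h)

/-- Since `S_n` is nondecreasing, the indices with `S_n ≤ t` form an initial segment, and its
supremum counts those with `n ≥ 1`. The index `n = 0` always belongs to it and is left out, hence
the shift. -/
theorem mixedRenewalProcess_eq_tsum {Ω : Type*} {T : ℕ → Ω → ℝ≥0} (t : ℝ≥0) (ω : Ω) :
    (mixedRenewalProcess T t ω : ℝ≥0∞) =
      ∑' m : ℕ, {ω | addingProcess T (m + 1) ω ≤ t}.indicator (fun _ => (1 : ℝ≥0∞)) ω := by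
  have hind : ∀ m : ℕ, addingProcess T (m + 1) ω ≤ t →
      {ω | addingProcess T (m + 1) ω ≤ t}.indicator (fun _ => (1 : ℝ≥0∞)) ω = 1 :=
    fun m hm => Set.indicator_of_mem (by exact hm) _
  by_cases h : ∀ n, addingProcess T n ω ≤ t
  · have h1 : mixedRenewalProcess T t ω = ⊤ := by
      refine ENat.eq_top_iff_forall_ge.2 fun n => ?_
      exact le_sSup ⟨n, rfl, h n⟩
    rw [h1, tsum_congr fun m => hind m (h _)]
    simp
  · push Not at h
    classical
    -- `N` is the first passage index above `t`. It is positive because `S_0 = 0`, and its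
    -- predecessor is the supremum.
    obtain ⟨N, hN, hmin⟩ : ∃ N, t < addingProcess T N ω ∧ ∀ n < N, addingProcess T n ω ≤ t :=
      ⟨Nat.find h, Nat.find_spec h, fun n hn => not_lt.1 (Nat.find_min h hn)⟩
    have hN0 : N ≠ 0 := by
      rintro rfl
      simp [addingProcess] at hN
    obtain ⟨N, rfl⟩ := Nat.exists_eq_succ_of_ne_zero hN0
    have hle : ∀ n, addingProcess T n ω ≤ t → n ≤ N := fun n hn => by
      by_contra hc
      exact absurd (hN.trans_le (addingProcess_mono ω (by omega : N.succ ≤ n))) (not_lt.2 hn)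
    have h1 : mixedRenewalProcess T t ω = N := by
      refine le_antisymm (sSup_le ?_) (le_sSup ⟨N, rfl, hmin N (Nat.lt_succ_self N)⟩)
      rintro _ ⟨n, rfl, hn⟩
      exact_mod_cast hle n hn
    rw [h1, tsum_eq_sum (s := Finset.range N)]
    · rw [Finset.sum_congr rfl fun m hm => hind m (hmin _ (by simpa using hm))]
      simp
    · intro m hm
      refine Set.indicator_of_notMem (fun hc => hm ?_) _
      exact Finset.mem_range.2 (hle _ hc)

theorem mixedRenewalFunction_eq_tsum {Ω : Type*} [MeasurableSpace Ω] {P : Measure Ω}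
    {T : ℕ → Ω → ℝ≥0} (hT : ∀ i, Measurable (T i)) (t : ℝ≥0) :
    mixedRenewalFunction P T t = ∑' m : ℕ, P {ω | addingProcess T (m + 1) ω ≤ t} := by
  have hm : ∀ m, MeasurableSet {ω | addingProcess T (m + 1) ω ≤ t} := fun m =>
    measurable_addingProcess hT (m + 1) measurableSet_Iic
  simp_rw [mixedRenewalFunction, mixedRenewalProcess_eq_tsum]
  rw [lintegral_tsum fun m => (measurable_const.indicator (hm m)).aemeasurable]
  simp_rw [lintegral_indicator_const (hm _), one_mul]

/-! ### The law of `S_n` and the renewal function. -/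

section Renewal

variable {Ω : Type*} [MeasurableSpace Ω] {P : Measure Ω} [IsProbabilityMeasure P]
  {H : Measure ℝ≥0} [IsProbabilityMeasure H] {α : ℝ} {F : Ω → ProbabilityMeasure ℝ≥0}
  {T : ℕ → Ω → ℝ≥0}

/-- Both sides have the same characteristic function: `exp(iθ S_n)` is a product over the sample,
and each `v`-term of the product formula is a weight times the characteristic function of
`partitionConv H v`. -/
theorem map_addingProcess (hα : 0 < α) (hF : IsDirichletProcess F α H P) (hT : IsCondIID T F P)
    (n : ℕ) :
    P.map (addingProcess T n) =
      ∑ v ∈ partitionVectors n, ENNReal.ofReal (partitionWeight α v) • partitionConv H v := by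
  have hm := measurable_addingProcess hT.measurable n
  have := Measure.isProbabilityMeasure_map (μ := P) hm.aemeasurable
  have (v : Fin n → ℕ) :
      IsFiniteMeasure (ENNReal.ofReal (partitionWeight α v) • partitionConv H v) :=
    Measure.smul_finite _ ENNReal.ofReal_ne_top
  refine measure_ext_of_nnCharFun fun θ => ?_
  rw [nnCharFun_sum_smul _ fun v _ => partitionWeight_nonneg hα v, nnCharFun,
    integral_map hm.aemeasurable (by fun_prop)]
  have e : ∀ ω, Complex.exp (θ * ((addingProcess T n ω : ℝ≥0) : ℝ) * Complex.I) =
      ∏ i : Fin n, Complex.exp (θ * ((T i ω : ℝ≥0) : ℝ) * Complex.I) := by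
    intro ω
    rw [← Complex.exp_sum, addingProcess, Finset.sum_range, ← Finset.sum_mul, ← Finset.mul_sum]
    push_cast
    rfl
  simp_rw [e]
  rw [hT.integral_prod_of_norm_le hα hF (f := fun x => Complex.exp (θ * (x : ℝ) * Complex.I))
    (Measurable.stronglyMeasurable (by fun_prop))
    (fun x => by rw [← Complex.ofReal_mul, Complex.norm_exp_ofReal_mul_I]), Finset.mul_sum]
  refine Finset.sum_congr rfl fun v _ => ?_
  rw [nnCharFun_partitionConv, partitionWeight]
  push_cast
  rw [mul_assoc, ← Finset.prod_mul_distrib]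
  congr 1
  refine Finset.prod_congr rfl fun j _ => ?_
  rw [div_pow, mul_pow, div_div, mul_div_right_comm]

theorem measureReal_addingProcess_le (hα : 0 < α) (hF : IsDirichletProcess F α H P)
    (hT : IsCondIID T F P) (n : ℕ) (t : ℝ≥0) :
    P.real {ω | addingProcess T n ω ≤ t} =
      (n ! : ℝ) / risingFactorial α n *
        ∑ v ∈ partitionVectors n,
          (∏ j : Fin n, α ^ v j / (((j : ℝ) + 1) ^ v j * ((v j)! : ℝ))) *
            (partitionConv H v).real (Set.Iic t) := by
  have hm := measurable_addingProcess hT.measurable n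
  have h : P {ω | addingProcess T n ω ≤ t} = (P.map (addingProcess T n)) (Set.Iic t) :=
    (Measure.map_apply hm measurableSet_Iic).symm
  rw [measureReal_def, h, map_addingProcess hα hF hT, Measure.finsetSum_apply,
    ENNReal.toReal_sum, Finset.mul_sum]
  · refine Finset.sum_congr rfl fun v _ => ?_
    rw [Measure.smul_apply, smul_eq_mul, ENNReal.toReal_mul,
      ENNReal.toReal_ofReal (partitionWeight_nonneg hα v), partitionWeight, mul_assoc]
    rfl
  · intro v _
    exact ENNReal.mul_ne_top ENNReal.ofReal_ne_top (measure_ne_top _ _)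

end Renewal

theorem mainTheorem6 {Ω : Type*} [MeasurableSpace Ω] (P : Measure Ω) [IsProbabilityMeasure P]
    (α : ℝ) (hα : 0 < α) (H : Measure ℝ≥0) [IsProbabilityMeasure H]
    (F : Ω → ProbabilityMeasure ℝ≥0) (hF : IsDirichletProcess F α H P)
    (T : ℕ → Ω → ℝ≥0) (hT : IsCondIID T F P) :
    (∀ (n : ℕ) (t : ℝ≥0),
      P.real {ω | addingProcess T n ω ≤ t} =
        (n ! : ℝ) / risingFactorial α n *
          ∑ v ∈ partitionVectors n,
            (∏ j : Fin n, α ^ v j / (((j : ℝ) + 1) ^ v j * ((v j)! : ℝ))) *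
              (partitionConv H v).real (Set.Iic t)) ∧
    (∀ t : ℝ≥0,
      mixedRenewalFunction P T t =
        ∑' m : ℕ, ENNReal.ofReal
          (((m + 1)! : ℝ) / risingFactorial α (m + 1) *
            ∑ v ∈ partitionVectors (m + 1),
              (∏ j : Fin (m + 1), α ^ v j / (((j : ℝ) + 1) ^ v j * ((v j)! : ℝ))) *
                (partitionConv H v).real (Set.Iic t))) := by
  refine ⟨measureReal_addingProcess_le hα hF hT, fun t => ?_⟩
  rw [mixedRenewalFunction_eq_tsum hT.measurable]
  refine tsum_congr fun m => ?_
  rw [← measureReal_addingProcess_le hα hF hT, ofReal_measureReal]
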